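/- Let $m\ge 1$ and equip $\mathbb{R}^m$ with the Euclidean norm. Let $Y\subset\mathbb{R}^m$ be a nonempty compact convex set, and let $$\mathcal{D}_Y:=\{K\subseteq Y : K \text{ is nonempty, convex and compact}\},$$ endowed with the Hausdorff metric $d_H$. Let $\lambda$ denote the Lebesgue measure on $\mathbb{R}^m$, $\mathbb{B}$ the unit ball of $\mathbb{R}^m$, $D\Delta E$ the symmetric difference of $D$ and $E$, and $$L_{Y,m}:=2m\,\lambda(\mathbb{B})\left(\mathrm{diam}(Y)\sqrt{\frac{m}{2(m+1)}}\right)^{m-1},$$ with the convention $0^0=1$. For a Lipschitz function $f$ on a metric space, $\mathrm{Lip}(f)$ denotes the infimum of the constants $L>0$ such that $f$ is $L$-Lipschitz. Then the function $\lambda:\mathcal{D}_Y\to\mathbb{R}$, $A\mapsto\lambda(A)$, is Lipschitz with respect to $d_H$, and $\mathrm{Lip}(\lambda)\le L_{Y,m}$. Moreover, for every $C\in\mathcal{D}_Y$ and every $L>L_{Y,m}$ there exists $\delta>0$ such that $$\lambda(D\Delta E)\le L\,d_H(D,E)$$ for all $D,E\in\mathcal{D}_Y$ with $d_H(D,C)<\delta$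 and $d_H(E,C)<\delta$. -/

import Mathlib

open MeasureTheory TopologicalSpace

/-- The space `𝒟_Y` of nonempty, compact, convex subsets of `Y ⊆ ℝ^m` (Euclidean norm). It carries
the subspace metric of `NonemptyCompacts`, whose distance is the Hausdorff distance `d_H`. -/
def ConvexCompacts {m : ℕ} (Y : Set (EuclideanSpace ℝ (Fin m))) :
    Set (NonemptyCompacts (EuclideanSpace ℝ (Fin m))) :=
  {K | Convex ℝ (K : Set (EuclideanSpace ℝ (Fin m))) ∧
    (K : Set (EuclideanSpace ℝ (Fin m))) ⊆ Y}

/-- Sanity check: the distance of `𝒟_Y` is the Hausdorff distance of the underlying sets. -/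
theorem ConvexCompacts.dist_eq {m : ℕ} {Y : Set (EuclideanSpace ℝ (Fin m))}
    (A B : ConvexCompacts Y) :
    dist A B = Metric.hausdorffDist (A.1 : Set (EuclideanSpace ℝ (Fin m)))
      (B.1 : Set (EuclideanSpace ℝ (Fin m))) :=
  rfl

/-- The set of (positive) Lipschitz constants of a map between metric spaces. -/
def lipConstants {M N : Type*} [MetricSpace M] [MetricSpace N] (f : M → N) : Set ℝ :=
  {L | 0 < L ∧ ∀ x x' : M, dist (f x) (f x') ≤ L * dist x x'}

/-- `f` is Lipschitz: it has a Lipschitz constant. -/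
def IsLipschitz {M N : Type*} [MetricSpace M] [MetricSpace N] (f : M → N) : Prop :=
  (lipConstants f).Nonempty

/-- `Lip(f)`, the infimum of the Lipschitz constants of `f` (meaningful when `f` is Lipschitz). -/
noncomputable def lipNumber {M N : Type*} [MetricSpace M] [MetricSpace N] (f : M → N) : ℝ :=
  sInf (lipConstants f)

/-- The Lebesgue measure `λ`, as a real function on `𝒟_Y`. -/
noncomputable def lebesgueVolume {m : ℕ} (Y : Set (EuclideanSpace ℝ (Fin m)))
    (A : ConvexCompacts Y) : ℝ :=
  volume.real (A.1 : Set (EuclideanSpace ℝ (Fin m)))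

/-- The constant `L_{Y,m} = 2 m λ(𝔹) (diam(Y) √(m / (2 (m + 1))))^(m - 1)`, where `𝔹` is the unit
ball of `ℝ^m`. -/
noncomputable def volumeLipConst {m : ℕ} (Y : Set (EuclideanSpace ℝ (Fin m))) : ℝ :=
  2 * (m : ℝ) * volume.real (Metric.closedBall (0 : EuclideanSpace ℝ (Fin m)) 1) *
    (Metric.diam Y * Real.sqrt ((m : ℝ) / (2 * ((m : ℝ) + 1)))) ^ (m - 1)

/-! By Jung's theorem `Y` lies in a ball of radius `R = diam(Y) √(m / (2(m + 1)))`. The core is that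
`λ(E + Z) - λ(E)` grows with the convex body `E` when `Z` is a ball. For a segment this follows from
sweeping volume; it passes to Minkowski sums of segments, and zonotopes approximate balls. Comparing
`E ⊆ B(p, R)` with `B(p, R)` itself gives `λ(E + h𝔹) - λ(E) ≤ λ(𝔹)((R + h)^m - R^m)`, at most `m
λ(𝔹) (R + h)^(m-1) h`.

Applied to `D \ E` and `E \ D`, this bounds the symmetric difference by twice that amount, whence
the local statement. For the global one, small steps along the segment from `E` to `D` in the space
of convex bodies replace `R + h` by `R`. -/

/-! ### Jung's theorem -/

section Jung

variable {V : Type*} [NormedAddCommGroup V] [InnerProductSpace ℝ V]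

/-- The weighted sum of the squared mutual distances of finitely many points. -/
theorem sum_sum_mul_norm_sub_sq {ι : Type*} [Fintype ι] (x : ι → V) (w : ι → ℝ)
    (hw : ∑ i, w i = 1) :
    ∑ i, ∑ j, w i * w j * ‖x i - x j‖ ^ 2 =
      2 * (∑ i, w i * ‖x i‖ ^ 2 - ‖∑ i, w i • x i‖ ^ 2) := by
  have h1 : ‖∑ i, w i • x i‖ ^ 2 = ∑ i, ∑ j, w i * w j * inner ℝ (x i) (x j) := by
    rw [← real_inner_self_eq_norm_sq, sum_inner]
    refine Finset.sum_congr rfl fun i _ => ?_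
    rw [inner_sum]
    refine Finset.sum_congr rfl fun j _ => ?_
    rw [real_inner_smul_left, real_inner_smul_right]
    ring
  have h2 : ∑ i, ∑ j, w i * w j * ‖x i‖ ^ 2 = ∑ i, w i * ‖x i‖ ^ 2 := by
    refine Finset.sum_congr rfl fun i _ => ?_
    rw [← Finset.sum_mul, ← Finset.mul_sum, hw, mul_one]
  have h3 : ∑ i, ∑ j, w i * w j * ‖x j‖ ^ 2 = ∑ i, w i * ‖x i‖ ^ 2 := by
    rw [Finset.sum_comm, ← h2]
    refine Finset.sum_congr rfl fun i _ => Finset.sum_congr rfl fun j _ => ?_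
    ring
  have h4 : ∀ i j, w i * w j * ‖x i - x j‖ ^ 2 =
      w i * w j * ‖x i‖ ^ 2 + w i * w j * ‖x j‖ ^ 2 - 2 * (w i * w j * inner ℝ (x i) (x j)) := by
    intro i j
    rw [norm_sub_sq_real]
    ring
  simp only [h4, Finset.sum_sub_distrib, Finset.sum_add_distrib, ← Finset.mul_sum]
  rw [h1, h2, h3]
  ring

/-- **Jung's theorem** for finitely many points. -/
theorem exists_norm_sub_sq_le_of_finite {ι : Type*} [Fintype ι] [Nonempty ι] (x : ι → V) (d : ℝ)
    (hd : ∀ i j, ‖x i - x j‖ ≤ d) :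
    ∃ c : V, ∀ j, ‖x j - c‖ ^ 2 ≤ d ^ 2 * (1 - 1 / (Fintype.card ι : ℝ)) / 2 := by
  classical
  have hcont : Continuous fun w : ι → ℝ => ∑ i, w i * ‖x i‖ ^ 2 - ‖∑ i, w i • x i‖ ^ 2 := by
    fun_prop
  -- The centre is the barycentre for the weights maximizing the variance `S - ‖c‖ ^ 2`; that
  -- maximum bounds the squared radius.
  obtain ⟨w, hw, hmax⟩ := (isCompact_stdSimplex ℝ ι).exists_isMaxOn
    ⟨_, single_mem_stdSimplex ℝ (Classical.arbitrary ι)⟩ hcont.continuousOn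
  have hsum : ∑ i, w i = 1 := hw.2
  set c := ∑ i, w i • x i with hc
  set S := ∑ i, w i * ‖x i‖ ^ 2 with hS
  have hbound : S - ‖c‖ ^ 2 ≤ d ^ 2 * (1 - 1 / (Fintype.card ι : ℝ)) / 2 := by
    have h1 := sum_sum_mul_norm_sub_sq x w hsum
    have h2 : ∑ i, ∑ j, w i * w j * ‖x i - x j‖ ^ 2 ≤
        ∑ i, ∑ j, (w i * w j * d ^ 2 - if i = j then w i * w j * d ^ 2 else 0) := by
      refine Finset.sum_le_sum fun i _ => Finset.sum_le_sum fun j _ => ?_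
      split_ifs with hij
      · simp [hij]
      · rw [sub_zero]
        exact mul_le_mul_of_nonneg_left (pow_le_pow_left₀ (norm_nonneg _) (hd i j) 2)
          (mul_nonneg (hw.1 i) (hw.1 j))
    have h3 : ∑ i, ∑ j, (w i * w j * d ^ 2 - if i = j then w i * w j * d ^ 2 else 0) =
        d ^ 2 * (1 - ∑ i, w i ^ 2) := by
      simp only [Finset.sum_sub_distrib, Finset.sum_ite_eq, Finset.mem_univ, if_true,
        ← Finset.sum_mul, ← Finset.mul_sum, hsum]
      simp only [← pow_two]
      ring
    have h4 : 1 / (Fintype.card ι : ℝ) ≤ ∑ i, w i ^ 2 := by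
      have := sq_sum_le_card_mul_sum_sq (s := Finset.univ) (f := w)
      rw [hsum, Finset.card_univ] at this
      rw [div_le_iff₀ (by exact_mod_cast Fintype.card_pos)]
      linarith
    have h5 := mul_le_mul_of_nonneg_left h4 (sq_nonneg d)
    linarith
  refine ⟨c, fun j => le_trans ?_ hbound⟩
  -- First-order optimality: move the weights a fraction `t` towards the vertex `j`, divide by `t`,
  -- then let `t → 0`.
  have key : ∀ t ∈ Set.Ioc (0 : ℝ) 1, ‖x j - c‖ ^ 2 - (S - ‖c‖ ^ 2) ≤ t * ‖x j - c‖ ^ 2 := by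
    rintro t ⟨ht0, ht1⟩
    have hmem : (1 - t) • w + t • (Pi.single j 1 : ι → ℝ) ∈ stdSimplex ℝ ι :=
      convex_stdSimplex ℝ ι hw (single_mem_stdSimplex ℝ j) (by linarith) ht0.le (by ring)
    have h1 := hmax hmem
    have e1 : ∑ i, ((1 - t) • w + t • (Pi.single j (1 : ℝ) : ι → ℝ)) i * ‖x i‖ ^ 2 =
        (1 - t) * S + t * ‖x j‖ ^ 2 := by
      simp [add_mul, Finset.sum_add_distrib, hS, Finset.mul_sum, mul_assoc, Pi.single_apply]
    have e2 : ∑ i, ((1 - t) • w + t • (Pi.single j (1 : ℝ) : ι → ℝ)) i • x i = c + t • (x j - c) := by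
      have : c + t • (x j - c) = (1 - t) • c + t • x j := by module
      rw [this]
      simp [add_smul, Finset.sum_add_distrib, hc, Finset.smul_sum, mul_smul, Pi.single_apply]
    simp only [Set.mem_ofPred_eq, e1, e2] at h1
    rw [← hS, ← hc, norm_add_sq_real, norm_smul, real_inner_smul_right, inner_sub_right,
      real_inner_self_eq_norm_sq, Real.norm_of_nonneg ht0.le] at h1
    have h2 : t * (‖x j - c‖ ^ 2 - (S - ‖c‖ ^ 2)) ≤ t * (t * ‖x j - c‖ ^ 2) := by
      have : ‖x j - c‖ ^ 2 = ‖x j‖ ^ 2 - 2 * inner ℝ c (x j) + ‖c‖ ^ 2 := by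
        rw [norm_sub_sq_real, real_inner_comm]
      nlinarith
    exact le_of_mul_le_mul_left h2 ht0
  have hlim : Filter.Tendsto (fun t : ℝ => t * ‖x j - c‖ ^ 2) (nhdsWithin 0 (Set.Ioi 0))
      (nhds 0) := by
    have : Filter.Tendsto (fun t : ℝ => t * ‖x j - c‖ ^ 2) (nhds 0) (nhds (0 * ‖x j - c‖ ^ 2)) :=
      (continuous_id.mul continuous_const).tendsto 0
    rw [zero_mul] at this
    exact this.mono_left nhdsWithin_le_nhds
  have := ge_of_tendsto hlim (Filter.eventually_of_mem (Ioc_mem_nhdsGT zero_lt_one) key)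
  linarith

/-- **Jung's theorem**: a bounded set of diameter `d` in a Euclidean space of dimension `m` lies in
a closed ball of radius `d √(m / (2 (m + 1)))`. -/
theorem exists_subset_closedBall_diam [FiniteDimensional ℝ V] {Y : Set V}
    (hY : Bornology.IsBounded Y) :
    ∃ p : V, Y ⊆ Metric.closedBall p (Metric.diam Y *
      Real.sqrt ((Module.finrank ℝ V : ℝ) / (2 * ((Module.finrank ℝ V : ℝ) + 1)))) := by
  set n := Module.finrank ℝ V
  set R := Metric.diam Y * Real.sqrt ((n : ℝ) / (2 * ((n : ℝ) + 1)))
  have hR : 0 ≤ R := mul_nonneg Metric.diam_nonneg (Real.sqrt_nonneg _)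
  have hR2 : R ^ 2 = Metric.diam Y ^ 2 * ((n : ℝ) / (2 * ((n : ℝ) + 1))) := by
    rw [mul_pow, Real.sq_sqrt (by positivity)]
  -- Helly reduces the problem to at most `n + 1` points of `Y`, the finite case.
  obtain ⟨p, hp⟩ := Convex.helly_theorem_compact' (𝕜 := ℝ)
    (F := fun y : Y => Metric.closedBall (y : V) R)
    (fun y => convex_closedBall _ _) (fun y => isCompact_closedBall _ _) (by
      intro I hI
      rcases I.eq_empty_or_nonempty with rfl | hne
      · simp
      have : Nonempty I := hne.to_subtype
      obtain ⟨c, hc⟩ := exists_norm_sub_sq_le_of_finite (fun i : I => ((i : Y) : V))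
        (Metric.diam Y) (fun i j => by
          rw [← dist_eq_norm]
          exact Metric.dist_le_diam_of_mem hY i.1.2 j.1.2)
      refine ⟨c, Set.mem_iInter₂.2 fun y hy => ?_⟩
      rw [Metric.mem_closedBall, dist_comm, dist_eq_norm]
      refine (pow_le_pow_iff_left₀ (norm_nonneg _) hR two_ne_zero).1 ((hc ⟨y, hy⟩).trans ?_)
      rw [hR2, mul_div_assoc]
      refine mul_le_mul_of_nonneg_left ?_ (sq_nonneg _)
      have h0 : (0 : ℝ) < I.card := by exact_mod_cast hne.card_pos
      have h1 : (I.card : ℝ) ≤ n + 1 := by exact_mod_cast hI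
      have h2 : 1 / ((n : ℝ) + 1) ≤ 1 / (I.card : ℝ) := one_div_le_one_div_of_le h0 h1
      have h3 : (n : ℝ) / (2 * ((n : ℝ) + 1)) = (1 - 1 / ((n : ℝ) + 1)) / 2 := by
        field_simp
        ring
      rw [h3, Fintype.card_coe]
      linarith)
  refine ⟨p, fun y hy => ?_⟩
  rw [Metric.mem_closedBall, dist_comm]
  exact Metric.mem_closedBall.1 (Set.mem_iInter.1 hp ⟨y, hy⟩)

end Jung

/-! ### Monotone volume increments for zonotopes -/

section Zonotope

open scoped Pointwise

variable {V : Type*} [NormedAddCommGroup V] [InnerProductSpace ℝ V]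

/-- The segment from `0` to `r • a`, as an image of `[0, r]`. -/
def originSegment (a : V) (r : ℝ) : Set V := (fun s : ℝ => s • a) '' Set.Icc 0 r

theorem isCompact_originSegment (a : V) (r : ℝ) : IsCompact (originSegment a r) :=
  isCompact_Icc.image (by fun_prop)

theorem convex_originSegment (a : V) (r : ℝ) : Convex ℝ (originSegment a r) :=
  (convex_Icc 0 r).is_linear_image ⟨fun x y => add_smul x y a, fun c x => mul_smul c x a⟩

theorem mem_add_originSegment {E : Set V} {a x : V} {r : ℝ} :
    x ∈ E + originSegment a r ↔ ∃ s ∈ Set.Icc (0 : ℝ) r, x - s • a ∈ E := by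
  constructor
  · rintro ⟨e, he, _, ⟨s, hs, rfl⟩, rfl⟩
    exact ⟨s, hs, by simpa using he⟩
  · rintro ⟨s, hs, h⟩
    exact ⟨_, h, _, ⟨s, hs, rfl⟩, sub_add_cancel _ _⟩

/-- The zonotope spanned by the vectors `b i`. -/
def zonotope {ι : Type*} (s : Finset ι) (b : ι → V) : Set V := ∑ i ∈ s, originSegment (b i) 1

theorem mem_zonotope {ι : Type*} {s : Finset ι} {b : ι → V} {z : V} :
    z ∈ zonotope s b ↔ ∃ t : ι → ℝ, (∀ i ∈ s, t i ∈ Set.Icc (0 : ℝ) 1) ∧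
      ∑ i ∈ s, t i • b i = z := by
  rw [zonotope, Set.mem_finsetSum]
  constructor
  · rintro ⟨g, hg, rfl⟩
    choose! t ht using fun i (hi : i ∈ s) => @hg i hi
    exact ⟨t, fun i hi => (ht i hi).1, Finset.sum_congr rfl fun i hi => (ht i hi).2⟩
  · rintro ⟨t, ht, rfl⟩
    exact ⟨_, fun hi => ⟨_, ht _ hi, rfl⟩, rfl⟩

variable [FiniteDimensional ℝ V] [MeasurableSpace V] [BorelSpace V]

/-- Lengthening the segment from `N • a` to `(N + 1) • a` adds exactly the translate by `N • a` of
the first layer `(E + [0, a]) \ E`. -/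
theorem volume_real_add_originSegment_natCast {E : Set V} (hEc : IsCompact E) (hE : Convex ℝ E)
    (a : V) (N : ℕ) :
    volume.real (E + originSegment a N) =
      volume.real E + N * (volume.real (E + originSegment a 1) - volume.real E) := by
  have hsub : E ⊆ E + originSegment a 1 := fun x hx =>
    mem_add_originSegment.2 ⟨0, by simp, by simpa using hx⟩
  have hc : ∀ r, IsCompact (E + originSegment a r) :=
    fun r => hEc.add (isCompact_originSegment a r)
  have hdiff : volume.real ((E + originSegment a 1) \ E) =
      volume.real (E + originSegment a 1) - volume.real E :=
    measureReal_sdiff hsub hEc.measurableSet (hc 1).measure_lt_top.ne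
  induction N with
  | zero =>
    have : E + originSegment a 0 = E := by simp [originSegment]
    simp [this]
  | succ N ih =>
    have hunion : E + originSegment a ((N + 1 : ℕ) : ℝ) = (E + originSegment a N) ∪
        (((N : ℝ) • a) +ᵥ ((E + originSegment a 1) \ E)) := by
      ext x
      simp only [Set.mem_union, Set.mem_vadd_set_iff_neg_vadd_mem, Set.mem_sdiff,
        mem_add_originSegment, vadd_eq_add]
      constructor
      · rintro ⟨s, hs, h⟩
        by_cases hsN : s ≤ N
        · exact Or.inl ⟨s, ⟨hs.1, hsN⟩, h⟩
        by_cases hx : -((N : ℝ) • a) + x ∈ E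
        · exact Or.inl ⟨N, ⟨by positivity, le_rfl⟩, by rwa [neg_add_eq_sub] at hx⟩
        · refine Or.inr ⟨⟨s - N, ⟨by linarith, ?_⟩, ?_⟩, hx⟩
          · have := hs.2
            push_cast at this
            linarith
          · convert h using 1
            module
      · rintro (⟨s, hs, h⟩ | ⟨⟨s, hs, h⟩, -⟩)
        · exact ⟨s, ⟨hs.1, hs.2.trans (by simp)⟩, h⟩
        · refine ⟨N + s, ⟨by have := hs.1; positivity, ?_⟩, ?_⟩
          · push_cast
            linarith [hs.2]
          · convert h using 1
            module
    have hdisj : Disjoint (E + originSegment a N)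
        (((N : ℝ) • a) +ᵥ ((E + originSegment a 1) \ E)) := by
      rw [Set.disjoint_left]
      intro x hx hx'
      simp only [Set.mem_vadd_set_iff_neg_vadd_mem, Set.mem_sdiff,
        mem_add_originSegment, vadd_eq_add] at hx hx'
      obtain ⟨s, hs, h⟩ := hx
      obtain ⟨⟨t, ht, h'⟩, hn⟩ := hx'
      apply hn
      rcases eq_or_lt_of_le ht.1 with rfl | htpos
      · simpa using h'
      have hpos : 0 < N - s + t := by linarith [hs.2]
      -- `x - N • a` lies between two points of `E` on a line parallel to `a`.
      have := hE h h' (a := t / (N - s + t)) (b := (N - s) / (N - s + t))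
        (by positivity) (div_nonneg (by linarith [hs.2]) hpos.le) (by field_simp; ring)
      convert this using 1
      match_scalars <;> field_simp <;> ring
    rw [hunion, measureReal_union hdisj
      (((hc 1).measurableSet.diff hEc.measurableSet).const_vadd _)
      (hc N).measure_lt_top.ne
      (by rw [measure_vadd]; exact measure_ne_top_of_subset Set.sdiff_subset (hc 1).measure_lt_top.ne), ih, measureReal_def (s := _ +ᵥ _), measure_vadd, ← measureReal_def, hdiff]
    push_cast
    ring

/-- The volume increment caused by adding `Z` is monotone on compact convex sets. -/
def HasMonotoneVolumeIncrement (Z : Set V) : Prop :=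
  ∀ E K : Set V, IsCompact E → Convex ℝ E → IsCompact K → Convex ℝ K → E ⊆ K →
    volume.real (E + Z) + volume.real K ≤ volume.real (K + Z) + volume.real E

/-- Both volumes are affine in `N`. A larger slope for `E` than for `K` would eventually violate `E
+ [0, N a] ⊆ K + [0, N a]`. -/
theorem hasMonotoneVolumeIncrement_originSegment (a : V) :
    HasMonotoneVolumeIncrement (originSegment a 1) := by
  intro E K hEc hE hKc hK hEK
  by_contra! hlt
  obtain ⟨N, hN⟩ := exists_nat_gt ((volume.real K - volume.real E) /
    (volume.real (E + originSegment a 1) + volume.real K -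
      (volume.real (K + originSegment a 1) + volume.real E)))
  rw [div_lt_iff₀ (by linarith)] at hN
  have h : volume.real (E + originSegment a N) ≤ volume.real (K + originSegment a N) :=
    measureReal_mono (Set.add_subset_add_right hEK)
      (hKc.add (isCompact_originSegment a N)).measure_lt_top.ne
  rw [volume_real_add_originSegment_natCast hEc hE, volume_real_add_originSegment_natCast hKc hK]
    at h
  linarith

theorem HasMonotoneVolumeIncrement.add {Z W : Set V} (hZ : HasMonotoneVolumeIncrement Z)
    (hW : HasMonotoneVolumeIncrement W) (hZc : IsCompact Z) (hZconv : Convex ℝ Z) :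
    HasMonotoneVolumeIncrement (Z + W) := by
  intro E K hEc hE hKc hK hEK
  have h1 := hZ E K hEc hE hKc hK hEK
  have h2 := hW (E + Z) (K + Z) (hEc.add hZc) (hE.add hZconv) (hKc.add hZc) (hK.add hZconv)
    (Set.add_subset_add_right hEK)
  rw [← add_assoc, ← add_assoc]
  linarith

theorem zonotope_properties {ι : Type*} (s : Finset ι) (b : ι → V) :
    IsCompact (zonotope s b) ∧ Convex ℝ (zonotope s b) ∧
      HasMonotoneVolumeIncrement (zonotope s b) := by
  classical
  unfold zonotope
  induction s using Finset.induction_on with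
  | empty =>
    refine ⟨by simp, by simp [← Set.singleton_zero], ?_⟩
    intro E K _ _ _ _ _
    simp [add_comm]
  | insert i s hi ih =>
    rw [Finset.sum_insert hi]
    exact ⟨(isCompact_originSegment _ _).add ih.1, (convex_originSegment _ _).add ih.2.1,
      (hasMonotoneVolumeIncrement_originSegment _).add ih.2.2 (isCompact_originSegment _ _)
        (convex_originSegment _ _)⟩

end Zonotope

/-! ### Approximating balls by zonotopes, and volume estimates -/

section BallApproximation

open scoped Pointwise

variable {V : Type*} [NormedAddCommGroup V] [InnerProductSpace ℝ V]

/-- The sum is the support function of the zonotope at `u`; evaluating it at `u = z` bounds `‖z‖`.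
-/
theorem zonotope_subset_closedBall {ι : Type*} {s : Finset ι} {b : ι → V} {r : ℝ}
    (hr : 0 ≤ r) (h : ∀ u, ∑ i ∈ s, max 0 (inner ℝ (b i) u) ≤ r * ‖u‖) :
    zonotope s b ⊆ Metric.closedBall 0 r := by
  intro z hz
  obtain ⟨t, ht, hsum⟩ := mem_zonotope.1 hz
  rw [mem_closedBall_zero_iff]
  have h1 : ‖z‖ * ‖z‖ ≤ r * ‖z‖ := by
    refine le_trans ?_ (h z)
    rw [← real_inner_self_eq_norm_mul_norm]
    nth_rewrite 1 [← hsum]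
    rw [sum_inner]
    refine Finset.sum_le_sum fun i hi => ?_
    rw [real_inner_smul_left]
    rcases le_total 0 (inner ℝ (b i) z) with h0 | h0
    · rw [max_eq_right h0]
      exact mul_le_of_le_one_left h0 (ht i hi).2
    · exact (mul_nonpos_of_nonneg_of_nonpos (ht i hi).1 h0).trans (le_max_left _ _)
  rcases eq_or_lt_of_le (norm_nonneg z) with h0 | h0
  · rwa [← h0]
  · exact le_of_mul_le_mul_right h1 h0

/-- A point outside would be strictly separated by some `u`, but the zonotope attains its support
function by keeping the `b i` with `0 ≤ ⟪b i, u⟫`. -/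
theorem closedBall_subset_zonotope [CompleteSpace V] {ι : Type*} {s : Finset ι} {b : ι → V} {r : ℝ}
    (hcompact : IsCompact (zonotope s b)) (hconvex : Convex ℝ (zonotope s b))
    (h : ∀ u, r * ‖u‖ ≤ ∑ i ∈ s, max 0 (inner ℝ (b i) u)) :
    Metric.closedBall 0 r ⊆ zonotope s b := by
  intro x hx
  rw [mem_closedBall_zero_iff] at hx
  by_contra hxz
  obtain ⟨f, c, hc, hcx⟩ := geometric_hahn_banach_closed_point hconvex hcompact.isClosed hxz
  set u := (InnerProductSpace.toDual ℝ V).symm f with hu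
  have hf : ∀ y, f y = inner ℝ u y := fun y => by simp [hu]
  have hmem : ∑ i ∈ s, (if 0 ≤ inner ℝ (b i) u then (1 : ℝ) else 0) • b i ∈ zonotope s b :=
    mem_zonotope.2 ⟨_, fun i _ => by split_ifs <;> simp, rfl⟩
  have h1 := hc _ hmem
  have h2 : f (∑ i ∈ s, (if 0 ≤ inner ℝ (b i) u then (1 : ℝ) else 0) • b i) =
      ∑ i ∈ s, max 0 (inner ℝ (b i) u) := by
    rw [map_sum]
    refine Finset.sum_congr rfl fun i _ => ?_
    rw [map_smul, hf, real_inner_comm]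
    split_ifs with h0
    · rw [max_eq_right h0, one_smul]
    · rw [max_eq_left (not_le.1 h0).le, zero_smul]
  have h3 : f x ≤ r * ‖u‖ := by
    rw [hf]
    refine (real_inner_le_norm _ _).trans ?_
    rw [mul_comm]
    exact mul_le_mul_of_nonneg_right hx (norm_nonneg _)
  linarith [h u]

variable [FiniteDimensional ℝ V] [MeasurableSpace V] [BorelSpace V]

/-- A reflection exchanging `u` and `v` preserves the ball and the measure. -/
theorem setIntegral_closedBall_max_inner_eq {u v : V} (huv : ‖u‖ = ‖v‖) :
    ∫ a in Metric.closedBall (0 : V) 1, max 0 (inner ℝ a u) =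
      ∫ a in Metric.closedBall (0 : V) 1, max 0 (inner ℝ a v) := by
  set T := (ℝ ∙ (v - u))ᗮ.reflection
  have hT : T v = u := Submodule.reflection_sub huv.symm
  have h := T.measurePreserving.setIntegral_preimage_emb
    T.toHomeomorph.measurableEmbedding (fun a : V => max 0 (inner ℝ a u)) (Metric.closedBall 0 1)
  rw [← h]
  have hpre : T ⁻¹' Metric.closedBall (0 : V) 1 = Metric.closedBall 0 1 := by
    ext x
    simp
  rw [hpre]
  simp only [← hT, LinearIsometryEquiv.inner_map_map]

theorem setIntegral_closedBall_max_inner_pos {u : V} (hu : u ≠ 0) :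
    0 < ∫ a in Metric.closedBall (0 : V) 1, max 0 (inner ℝ a u) := by
  have hcont : Continuous fun a : V => max 0 (inner ℝ a u) := by fun_prop
  rw [setIntegral_pos_iff_support_of_nonneg_ae (f := fun a : V => max 0 (inner ℝ a u))
    (Filter.Eventually.of_forall fun a => le_max_left _ _)
    (hcont.continuousOn.integrableOn_compact (isCompact_closedBall _ _))]
  have hopen : IsOpen ({a : V | 0 < inner ℝ a u} ∩ Metric.ball 0 1) :=
    (isOpen_lt continuous_const (by fun_prop)).inter Metric.isOpen_ball
  have hpos : 0 < ‖u‖ := norm_pos_iff.2 hu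
  refine (hopen.measure_pos volume ⟨((2 * ‖u‖)⁻¹) • u, ?_, ?_⟩).trans_le
    (measure_mono (Set.inter_subset_inter (fun a ha => ?_) Metric.ball_subset_closedBall))
  · change 0 < inner ℝ (((2 * ‖u‖)⁻¹) • u) u
    rw [real_inner_smul_left, real_inner_self_eq_norm_sq]
    positivity
  · rw [mem_ball_zero_iff, norm_smul, Real.norm_of_nonneg (by positivity)]
    field_simp
    norm_num
  · have h0 : 0 < inner ℝ a u := ha
    rw [Function.mem_support, max_eq_right h0.le]
    exact h0.ne'

/-- The norm is approximated by support functions of zonotopes. -/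
theorem exists_sum_max_inner_approx [Nontrivial V] {r ε : ℝ} (hr : 0 < r) (hε : 0 < ε) :
    ∃ (ι : Type) (s : Finset ι) (b : ι → V),
      ∀ u, |∑ i ∈ s, max 0 (inner ℝ (b i) u) - r * ‖u‖| ≤ ε * ‖u‖ := by
  have : Nonempty (Metric.sphere (0 : V) 1) := (NormedSpace.sphere_nonempty.2 zero_le_one).to_subtype
  obtain ⟨e, he⟩ := exists_norm_eq V zero_le_one
  have he0 : e ≠ 0 := by
    rintro rfl
    simp at he
  -- `F a` is the support function of the segment `[0, a]` on the sphere. Its average over the ball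
  -- is constant by symmetry and lies in the closed convex hull of the range, so finite convex
  -- combinations approximate it uniformly.
  let F : C(V, C(Metric.sphere (0 : V) 1, ℝ)) :=
    ContinuousMap.curry ⟨fun p => max 0 (inner ℝ p.1 (p.2 : V)), by fun_prop⟩
  have hF : ∀ a u, F a u = max 0 (inner ℝ a (u : V)) := fun a u => rfl
  set B := Metric.closedBall (0 : V) 1
  have hBpos : 0 < volume.real B :=
    ENNReal.toReal_pos (Metric.measure_closedBall_pos _ _ one_pos).ne'
      (isCompact_closedBall _ _).measure_lt_top.ne
  have hint : IntegrableOn F B := F.continuous.continuousOn.integrableOn_compact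
    (isCompact_closedBall _ _)
  have hmem := (convex_convexHull ℝ (Set.range F)).set_average_mem_closure
    (μ := volume) (t := B) (f := F) (Metric.measure_closedBall_pos _ _ one_pos).ne'
    (isCompact_closedBall _ _).measure_lt_top.ne
    (Filter.Eventually.of_forall fun a => subset_convexHull ℝ _ ⟨a, rfl⟩) hint
  set I := ∫ a in B, max 0 (inner ℝ a e)
  have hIpos : 0 < I := setIntegral_closedBall_max_inner_pos he0
  set c := (volume.real B)⁻¹ * I
  have hc : 0 < c := by positivity
  have havg : ∀ u : Metric.sphere (0 : V) 1, (⨍ a in B, F a) u = c := by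
    intro u
    rw [setAverage_eq, ContinuousMap.smul_apply, smul_eq_mul]
    congr 1
    have h1 := (ContinuousMap.evalCLM ℝ u).integral_comp_comm hint
    change _ = (∫ a in B, F a) u at h1
    rw [← h1]
    exact setIntegral_closedBall_max_inner_eq (u := (u : V)) (v := e)
      ((norm_eq_of_mem_sphere u).trans he.symm)
  obtain ⟨G, hG, hdist⟩ := Metric.mem_closure_iff.1 hmem (c * ε / r) (by positivity)
  obtain ⟨ι, _, w, z, hw, -, hz, hG⟩ := mem_convexHull_iff_exists_fintype.1 hG
  choose a ha using hz
  refine ⟨ι, Finset.univ, fun i => (r / c * w i) • a i, fun u => ?_⟩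
  rcases eq_or_ne u 0 with rfl | hu
  · simp
  have hn : 0 < ‖u‖ := norm_pos_iff.2 hu
  let v : Metric.sphere (0 : V) 1 := ⟨‖u‖⁻¹ • u, by
    rw [mem_sphere_zero_iff_norm, norm_smul, norm_inv, norm_norm, inv_mul_cancel₀ hn.ne']⟩
  have hGv : |G v - c| ≤ c * ε / r := by
    have h1 := (ContinuousMap.dist_apply_le_dist (f := ⨍ a in B, F a) (g := G) v).trans hdist.le
    rwa [havg, dist_comm, Real.dist_eq] at h1
  have hsum : ∑ i, max 0 (inner ℝ ((r / c * w i) • a i) u) = r / c * ‖u‖ * G v := by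
    have h1 : G v = ∑ i, w i * max 0 (inner ℝ (a i) (‖u‖⁻¹ • u)) := by
      rw [← hG, ContinuousMap.sum_apply]
      refine Finset.sum_congr rfl fun i _ => ?_
      rw [ContinuousMap.smul_apply, ← ha i, hF, smul_eq_mul]
    rw [h1, Finset.mul_sum]
    refine Finset.sum_congr rfl fun i _ => ?_
    have hw0 : 0 ≤ r / c * w i := mul_nonneg (by positivity) (hw i)
    have hmax : ∀ {t x : ℝ}, 0 ≤ t → max 0 (t * x) = t * max 0 x := fun {t x} ht => by
      simpa using (mul_max_of_nonneg 0 x ht).symm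
    rw [real_inner_smul_left, real_inner_smul_right, hmax hw0, hmax (by positivity)]
    field_simp
  have heq : r / c * ‖u‖ * G v - r * ‖u‖ = r / c * ‖u‖ * (G v - c) := by
    field_simp
  rw [hsum, heq, abs_mul, abs_of_pos (by positivity)]
  calc r / c * ‖u‖ * |G v - c| ≤ r / c * ‖u‖ * (c * ε / r) := by gcongr
    _ = ε * ‖u‖ := by field_simp

/-- Balls are sandwiched, up to an arbitrarily small error, by sets with monotone volume
increments. -/
theorem exists_hasMonotoneVolumeIncrement_between [Nontrivial V] {h η : ℝ} (hh : 0 ≤ h)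
    (hη : 0 < η) :
    ∃ Z : Set V, IsCompact Z ∧ HasMonotoneVolumeIncrement Z ∧ Metric.closedBall 0 h ⊆ Z ∧
      Z ⊆ Metric.closedBall 0 (h + η) := by
  obtain ⟨ι, s, b, hb⟩ := exists_sum_max_inner_approx (V := V) (r := h + η / 2) (ε := η / 2)
    (by positivity) (by positivity)
  obtain ⟨hc, hconv, hmono⟩ := zonotope_properties s b
  refine ⟨zonotope s b, hc, hmono, closedBall_subset_zonotope hc hconv fun u => ?_,
    zonotope_subset_closedBall (by positivity) fun u => ?_⟩
  · linarith [(abs_le.1 (hb u)).1]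
  · linarith [(abs_le.1 (hb u)).2]

theorem volume_real_add_closedBall_sub_le [Nontrivial V] {E : Set V} (hEc : IsCompact E)
    (hE : Convex ℝ E) {p : V} {R h : ℝ} (hR : 0 ≤ R) (hh : 0 ≤ h)
    (hER : E ⊆ Metric.closedBall p R) :
    volume.real (E + Metric.closedBall 0 h) - volume.real E ≤
      volume.real (Metric.closedBall (0 : V) 1) *
        ((R + h) ^ Module.finrank ℝ V - R ^ Module.finrank ℝ V) := by
  have hball : ∀ r, 0 ≤ r → volume.real (Metric.closedBall p r) =
      volume.real (Metric.closedBall (0 : V) 1) * r ^ Module.finrank ℝ V := by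
    intro r hr
    rw [Measure.addHaar_real_closedBall' volume p hr, mul_comm]
  have key : ∀ η ∈ Set.Ioi (0 : ℝ), volume.real (E + Metric.closedBall 0 h) - volume.real E ≤
      volume.real (Metric.closedBall (0 : V) 1) *
        ((R + (h + η)) ^ Module.finrank ℝ V - R ^ Module.finrank ℝ V) := by
    intro η hη
    have hη0 : 0 < η := hη
    obtain ⟨Z, hZc, hZ, hZ1, hZ2⟩ := exists_hasMonotoneVolumeIncrement_between (V := V) hh hη0
    have h1 := hZ E (Metric.closedBall p R) hEc hE (isCompact_closedBall _ _)
      (convex_closedBall _ _) hER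
    have h2 : volume.real (E + Metric.closedBall 0 h) ≤ volume.real (E + Z) :=
      measureReal_mono (Set.add_subset_add_left hZ1) (hEc.add hZc).measure_lt_top.ne
    have h3 : volume.real (Metric.closedBall p R + Z) ≤
        volume.real (Metric.closedBall p (R + (h + η))) := by
      refine measureReal_mono ?_ (isCompact_closedBall _ _).measure_lt_top.ne
      refine (Set.add_subset_add_left hZ2).trans ?_
      rw [closedBall_add_closedBall hR (by positivity), add_zero]
    rw [hball _ hR] at h1
    rw [hball _ (by positivity)] at h3
    rw [mul_sub]
    linarith
  have hlim : Filter.Tendsto (fun η : ℝ => volume.real (Metric.closedBall (0 : V) 1) *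
      ((R + (h + η)) ^ Module.finrank ℝ V - R ^ Module.finrank ℝ V))
      (nhdsWithin 0 (Set.Ioi 0)) (nhds (volume.real (Metric.closedBall (0 : V) 1) *
      ((R + (h + 0)) ^ Module.finrank ℝ V - R ^ Module.finrank ℝ V))) :=
    (Continuous.tendsto (by fun_prop) 0).mono_left nhdsWithin_le_nhds
  rw [add_zero] at hlim
  exact ge_of_tendsto hlim (Filter.eventually_of_mem self_mem_nhdsWithin key)

theorem pow_sub_pow_le_mul {x y : ℝ} (hx : 0 ≤ x) (hy : 0 ≤ y) (n : ℕ) :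
    (x + y) ^ n - x ^ n ≤ n * y * (x + y) ^ (n - 1) := by
  have hs := (Commute.all (x + y) x).geom_sum₂_mul n
  rw [← hs, add_sub_cancel_left]
  have : ∑ i ∈ Finset.range n, (x + y) ^ i * x ^ (n - 1 - i) ≤
      ∑ _i ∈ Finset.range n, (x + y) ^ (n - 1) := by
    refine Finset.sum_le_sum fun i hi => ?_
    have hi' : i + (n - 1 - i) = n - 1 := by
      have := Finset.mem_range.1 hi
      omega
    calc (x + y) ^ i * x ^ (n - 1 - i) ≤ (x + y) ^ i * (x + y) ^ (n - 1 - i) := by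
          gcongr
          linarith
      _ = (x + y) ^ (n - 1) := by rw [← pow_add, hi']
  rw [Finset.sum_const, Finset.card_range, nsmul_eq_mul] at this
  nlinarith

theorem volume_real_add_closedBall_sub_le_mul [Nontrivial V] {E : Set V} (hEc : IsCompact E)
    (hE : Convex ℝ E) {p : V} {R h : ℝ} (hR : 0 ≤ R) (hh : 0 ≤ h)
    (hER : E ⊆ Metric.closedBall p R) :
    volume.real (E + Metric.closedBall 0 h) - volume.real E ≤
      Module.finrank ℝ V * volume.real (Metric.closedBall (0 : V) 1) *
        (R + h) ^ (Module.finrank ℝ V - 1) * h := by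
  refine (volume_real_add_closedBall_sub_le hEc hE hR hh hER).trans ?_
  have := mul_le_mul_of_nonneg_left (pow_sub_pow_le_mul hR hh (Module.finrank ℝ V))
    (measureReal_nonneg (μ := volume) (s := Metric.closedBall (0 : V) 1))
  linarith

theorem volume_real_symmDiff_le [Nontrivial V] {D E : Set V} (hDc : IsCompact D)
    (hD : Convex ℝ D) (hEc : IsCompact E) (hE : Convex ℝ E) {p : V} {R h : ℝ} (hR : 0 ≤ R)
    (hh : 0 ≤ h) (hDR : D ⊆ Metric.closedBall p R) (hER : E ⊆ Metric.closedBall p R)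
    (hDE : D ⊆ E + Metric.closedBall 0 h) (hED : E ⊆ D + Metric.closedBall 0 h) :
    volume.real (symmDiff D E) ≤
      2 * Module.finrank ℝ V * volume.real (Metric.closedBall (0 : V) 1) *
        (R + h) ^ (Module.finrank ℝ V - 1) * h := by
  have hdiff : ∀ {A B : Set V}, IsCompact B → Convex ℝ B → B ⊆ Metric.closedBall p R →
      A ⊆ B + Metric.closedBall 0 h → volume.real (A \ B) ≤
      Module.finrank ℝ V * volume.real (Metric.closedBall (0 : V) 1) *
        (R + h) ^ (Module.finrank ℝ V - 1) * h := by
    intro A B hBc hB hBR hAB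
    refine le_trans ?_ (volume_real_add_closedBall_sub_le_mul hBc hB hR hh hBR)
    have hfin : volume (B + Metric.closedBall 0 h) ≠ ⊤ :=
      (hBc.add (isCompact_closedBall _ _)).measure_lt_top.ne
    have hsub : B ⊆ B + Metric.closedBall 0 h := fun x hx =>
      ⟨x, hx, 0, by simpa using hh, add_zero x⟩
    rw [← measureReal_sdiff hsub
      hBc.measurableSet hfin]
    exact measureReal_mono (Set.sdiff_subset_sdiff_left hAB)
      (measure_ne_top_of_subset Set.sdiff_subset hfin)
  have h1 := hdiff hEc hE hER hDE
  have h2 := hdiff hDc hD hDR hED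
  have h3 : volume.real (symmDiff D E) ≤ volume.real (D \ E) + volume.real (E \ D) :=
    measureReal_union_le _ _
  linarith

/-- Along `K t = (1 - t) E + t D`, which stays in `B(p, R)`, each of `n + 1` equal steps costs a
thickening by `h / (n + 1)`. Summing and letting `n → ∞` removes the `h` from `R + h`. -/
theorem volume_real_sub_le_of_subset_add_closedBall [Nontrivial V] {D E : Set V}
    (hDc : IsCompact D) (hD : Convex ℝ D) (hEc : IsCompact E) (hE : Convex ℝ E) {p : V} {R h : ℝ}
    (hR : 0 ≤ R) (hh : 0 ≤ h) (hDR : D ⊆ Metric.closedBall p R) (hER : E ⊆ Metric.closedBall p R)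
    (hDE : D ⊆ E + Metric.closedBall 0 h) (hDne : D.Nonempty) (hEne : E.Nonempty) :
    volume.real D - volume.real E ≤
      Module.finrank ℝ V * volume.real (Metric.closedBall (0 : V) 1) *
        R ^ (Module.finrank ℝ V - 1) * h := by
  let K : ℝ → Set V := fun t => (1 - t) • E + t • D
  have hK0 : K 0 = E := by
    simp only [K, sub_zero, one_smul, Set.zero_smul_set hDne, add_zero]
  have hK1 : K 1 = D := by
    simp only [K, sub_self, one_smul, Set.zero_smul_set hEne, zero_add]
  have hKc : ∀ t, IsCompact (K t) := fun t => (hEc.smul _).add (hDc.smul _)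
  have hKconv : ∀ t, Convex ℝ (K t) := fun t => (hE.smul _).add (hD.smul _)
  have hKR : ∀ t ∈ Set.Icc (0 : ℝ) 1, K t ⊆ Metric.closedBall p R := by
    rintro t ht _ ⟨_, ⟨x, hx, rfl⟩, _, ⟨y, hy, rfl⟩, rfl⟩
    exact convex_closedBall p R (hER hx) (hDR hy) (sub_nonneg.2 ht.2) ht.1 (by ring)
  have hKstep : ∀ s t : ℝ, 0 ≤ s → s ≤ t → t ≤ 1 →
      K t ⊆ K s + Metric.closedBall 0 ((t - s) * h) := by
    intro s t hs hst ht
    have h1 : t • D = s • D + (t - s) • D := by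
      -- Splitting a dilate as a Minkowski sum needs convexity.
      rw [← hD.add_smul hs (sub_nonneg.2 hst), add_sub_cancel]
    have h2 : (1 - s) • E = (1 - t) • E + (t - s) • E := by
      rw [← hE.add_smul (sub_nonneg.2 ht) (sub_nonneg.2 hst)]
      congr 1
      ring
    have h3 : (t - s) • Metric.closedBall (0 : V) h = Metric.closedBall 0 ((t - s) * h) := by
      rw [smul_closedBall _ _ hh, smul_zero, Real.norm_of_nonneg (sub_nonneg.2 hst)]
    calc K t = (1 - t) • E + (s • D + (t - s) • D) := by rw [← h1]
      _ ⊆ (1 - t) • E + (s • D + (t - s) • (E + Metric.closedBall 0 h)) := by gcongr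
      _ = K s + Metric.closedBall 0 ((t - s) * h) := by
        simp only [K]
        rw [smul_add, h3, h2]
        abel
  set c := Module.finrank ℝ V * volume.real (Metric.closedBall (0 : V) 1)
  set k := Module.finrank ℝ V - 1
  have key : ∀ n : ℕ, volume.real D - volume.real E ≤ c * (R + 1 / ((n : ℝ) + 1) * h) ^ k * h := by
    intro n
    have hn : (0 : ℝ) < (n : ℝ) + 1 := by positivity
    have hstep : ∀ i ∈ Finset.range (n + 1),
        volume.real (K (((i + 1 : ℕ) : ℝ) / ((n : ℝ) + 1))) -
          volume.real (K ((i : ℝ) / ((n : ℝ) + 1))) ≤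
        c * (R + 1 / ((n : ℝ) + 1) * h) ^ k * (1 / ((n : ℝ) + 1) * h) := by
      intro i hi
      have hi' : ((i + 1 : ℕ) : ℝ) ≤ (n : ℝ) + 1 := by exact_mod_cast Finset.mem_range.1 hi
      have h1 : ((i + 1 : ℕ) : ℝ) / ((n : ℝ) + 1) ≤ 1 := (div_le_one hn).2 hi'
      have h2 : (i : ℝ) / ((n : ℝ) + 1) ≤ ((i + 1 : ℕ) : ℝ) / ((n : ℝ) + 1) := by
        gcongr
        simp
      have h3 : ((i + 1 : ℕ) : ℝ) / ((n : ℝ) + 1) - (i : ℝ) / ((n : ℝ) + 1) =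
          1 / ((n : ℝ) + 1) := by
        push_cast
        ring
      have h0 : 0 ≤ (i : ℝ) / ((n : ℝ) + 1) := by positivity
      have hsub := hKstep _ _ h0 h2 h1
      rw [h3] at hsub
      have h4 := volume_real_add_closedBall_sub_le_mul (hKc _) (hKconv _) hR
        (h := 1 / ((n : ℝ) + 1) * h) (by positivity) (hKR _ ⟨h0, h2.trans h1⟩)
      have h5 := measureReal_mono (μ := volume) hsub
        ((hKc _).add (isCompact_closedBall _ _)).measure_lt_top.ne
      linarith
    have hsum := Finset.sum_le_sum hstep
    rw [Finset.sum_range_sub (fun i : ℕ => volume.real (K ((i : ℝ) / ((n : ℝ) + 1)))),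
      Finset.sum_const, Finset.card_range, nsmul_eq_mul] at hsum
    push_cast at hsum
    rw [div_self hn.ne', zero_div, hK0, hK1] at hsum
    refine hsum.trans_eq ?_
    field_simp
  have hlim : Filter.Tendsto (fun n : ℕ => c * (R + 1 / ((n : ℝ) + 1) * h) ^ k * h) Filter.atTop
      (nhds (c * (R + 0 * h) ^ k * h)) :=
    ((((tendsto_one_div_add_atTop_nhds_zero_nat (𝕜 := ℝ)).mul_const h).const_add R).pow k
      |>.const_mul c).mul_const h
  rw [zero_mul, add_zero] at hlim
  exact ge_of_tendsto' hlim key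

end BallApproximation

/-! ### Hausdorff distance and the main theorem -/

open scoped Pointwise in
theorem NonemptyCompacts.subset_add_closedBall {V : Type*} [NormedAddCommGroup V]
    (A B : NonemptyCompacts V) :
    (A : Set V) ⊆ (B : Set V) + Metric.closedBall 0 (dist A B) := by
  intro x hx
  have hfin : Metric.hausdorffEDist (A : Set V) B ≠ ⊤ :=
    Metric.hausdorffEDist_ne_top_of_nonempty_of_bounded A.nonempty B.nonempty
      A.isCompact.isBounded B.isCompact.isBounded
  obtain ⟨y, hy, hxy⟩ := B.isCompact.exists_infDist_eq_dist B.nonempty x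
  refine ⟨y, hy, x - y, ?_, by simp⟩
  rw [mem_closedBall_zero_iff, ← dist_eq_norm, ← hxy]
  exact Metric.infDist_le_hausdorffDist_of_mem hx hfin

theorem mainTheorem9 (m : ℕ) (hm : 1 ≤ m) (Y : Set (EuclideanSpace ℝ (Fin m)))
    (hYne : Y.Nonempty) (hYcompact : IsCompact Y) (hYconvex : Convex ℝ Y) :
    IsLipschitz (lebesgueVolume Y) ∧
    lipNumber (lebesgueVolume Y) ≤ volumeLipConst Y ∧
    ∀ (C : ConvexCompacts Y) (L : ℝ), volumeLipConst Y < L →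
      ∃ δ : ℝ, 0 < δ ∧ ∀ D ∈ Metric.ball C δ, ∀ E ∈ Metric.ball C δ,
        volume.real (symmDiff (D.1 : Set (EuclideanSpace ℝ (Fin m)))
          (E.1 : Set (EuclideanSpace ℝ (Fin m)))) ≤ L * dist D E := by
  have hrank : Module.finrank ℝ (EuclideanSpace ℝ (Fin m)) = m := by simp
  have : Nontrivial (EuclideanSpace ℝ (Fin m)) :=
    Module.nontrivial_of_finrank_pos (R := ℝ) (by omega)
  obtain ⟨p, hp⟩ := exists_subset_closedBall_diam hYcompact.isBounded
  rw [hrank] at hp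
  set R := Metric.diam Y * Real.sqrt ((m : ℝ) / (2 * ((m : ℝ) + 1))) with hRdef
  have hR : 0 ≤ R := mul_nonneg Metric.diam_nonneg (Real.sqrt_nonneg _)
  set β := volume.real (Metric.closedBall (0 : EuclideanSpace ℝ (Fin m)) 1) with hβ
  have hβ0 : 0 ≤ β := measureReal_nonneg
  have hconst : volumeLipConst Y = 2 * (m : ℝ) * β * R ^ (m - 1) := rfl
  have hconst0 : 0 ≤ volumeLipConst Y := by
    rw [hconst]
    positivity
  have hball : ∀ A : ConvexCompacts Y,
      (A.1 : Set (EuclideanSpace ℝ (Fin m))) ⊆ Metric.closedBall p R := fun A => A.2.2.trans hp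
  have hsub : ∀ A B : ConvexCompacts Y, lebesgueVolume Y A - lebesgueVolume Y B ≤
      volumeLipConst Y * dist A B := by
    intro A B
    have h := volume_real_sub_le_of_subset_add_closedBall A.1.isCompact A.2.1 B.1.isCompact B.2.1
      hR dist_nonneg (hball A) (hball B) (NonemptyCompacts.subset_add_closedBall A.1 B.1)
      A.1.nonempty B.1.nonempty
    rw [hrank] at h
    have h1 : 0 ≤ (m : ℝ) * β * R ^ (m - 1) * dist A B := by positivity
    have h2 : (m : ℝ) * β * R ^ (m - 1) * dist A B ≤ volumeLipConst Y * dist A B := by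
      rw [hconst]
      linarith
    exact h.trans h2
  -- Lipschitz constants are required to be positive, whereas `volumeLipConst Y` can vanish (a
  -- one-point `Y` with `m ≥ 2`), hence the strict inequality.
  have hlip : ∀ L, volumeLipConst Y < L → L ∈ lipConstants (lebesgueVolume Y) := by
    refine fun L hL => ⟨hconst0.trans_lt hL, fun A B => ?_⟩
    refine le_trans ?_ (mul_le_mul_of_nonneg_right hL.le dist_nonneg)
    rw [Real.dist_eq, abs_sub_le_iff]
    exact ⟨hsub A B, dist_comm A B ▸ hsub B A⟩
  refine ⟨⟨_, hlip _ (lt_add_one _)⟩, le_of_forall_gt_imp_ge_of_dense fun L hL => ?_, fun C L hL => ?_⟩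
  · exact csInf_le ⟨0, fun _ h => h.1.le⟩ (hlip L hL)
  -- The constant at radius `R + h` stays below `L` for `|h| < ε`; taking `δ = ε / 2` forces `dist D
  -- E < ε`.
  have hcont : ContinuousAt (fun h : ℝ => 2 * (m : ℝ) * β * (R + h) ^ (m - 1)) 0 := by fun_prop
  have hev := hcont.eventually_lt (continuousAt_const (y := L)) (by simpa [hconst] using hL)
  obtain ⟨ε, hε, hεL⟩ := Metric.eventually_nhds_iff.1 hev
  refine ⟨ε / 2, half_pos hε, fun D hD E hE => ?_⟩
  have hDE : dist D E < ε := by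
    have := dist_triangle_right D E C
    rw [Metric.mem_ball] at hD hE
    linarith
  have h := volume_real_symmDiff_le D.1.isCompact D.2.1 E.1.isCompact E.2.1 hR dist_nonneg
    (hball D) (hball E) (NonemptyCompacts.subset_add_closedBall D.1 E.1)
    (dist_comm E.1 D.1 ▸ NonemptyCompacts.subset_add_closedBall E.1 D.1)
  rw [hrank] at h
  refine h.trans (mul_le_mul_of_nonneg_right (hεL ?_).le dist_nonneg)
  rw [dist_zero_right, Real.norm_of_nonneg dist_nonneg]
  exact hDE
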